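/- Rings are associative and unital, not necessarily commutative, and homomorphisms preserve $1$; $U(B)$ is the group of invertible elements of a ring $B$. For a ring $A$ and a subset $S\subseteq A$, let $i_S\colon A\to A_S$ be the universal homomorphism inverting $S$, i.e. $A_S=\langle A,\{x_s\}_{s\in S}\mid x_ss=sx_s=1\rangle$. A homomorphism $\varphi\colon A\to B$ to a nonzero ring determines a sequence $\mathcal S=(S_1,S_2,\dots)$, called a fully invertible system on $A$: put $A_0=A$, $\varphi_0=\varphi$, and inductively $S_{n+1}=\varphi_n^{-1}(U(B))\subseteq A_n$, $A_{n+1}=(A_n)_{S_{n+1}}$, and let $\varphi_{n+1}\colon A_{n+1}\to B$ be the homomorphism induced by $\varphi_n$. The rings $A_n$ depend only on $\mathcal S$; put $A_{\mathcal S}=\varinjlim_n A_n$. Let $F(A)$ be the set of all fully invertible systems on $A$. A fraction of $A$ is a finite tuple $\mathbf a=(a_1,\dots,a_n)$ with $a_1\in A$, $a_2\in A_{a_1}$, $a_3\in (A_{a_1})_{a_2}$, and so on; put $A_{\mathbf a}=(\cdots(A_{a_1})_{a_2}\cdots)_{a_n}$. Write $\mathbf a\in\mathcal S$ if, successively for $i=1,\dots,n$,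 the image of $a_i$ in $A_{i-1}$ under the map induced by the preceding conditions lies in $S_i$; then there is an induced homomorphism $A_{\mathbf a}\to A_{\mathcal S}$. The sets $D(\mathbf a)=\{\mathcal S\in F(A)\mid \mathbf a\in\mathcal S\}$ form a base of the topology of $F(A)$. The structure sheaf $\mathcal O_A$ assigns to an open set $U\subseteq F(A)$ the ring of functions $t$ on $U$ with $t(\mathcal S)\in A_{\mathcal S}$ that are locally given by elements of rings $A_{\mathbf a}$: each point of $U$ has an open neighbourhood $V\subseteq U$ for which there are a fraction $\mathbf a$ with $V\subseteq D(\mathbf a)$ and an element $b\in A_{\mathbf a}$ such that $t(\mathcal S)$ is the image of $b$ in $A_{\mathcal S}$ for all $\mathcal S\in V$. An F-scheme is a ringed space (a topological space with a sheaf of rings) each point of which has an open neighbourhood isomorphic, as a ringed space, to $(F(R),\mathcal O_R)$ for some ring $R$. A morphism of F-schemes is a morphism of ringed spaces $(f,f^\sharp)\colon X\to Y$ such that for every $x\in X$ the stalk map $f^\sharp_x\colon\mathcal O_{Y,f(x)}\to\mathcal O_{X,x}$ is local, i.e. $f^\sharp_x(a)$ is invertible only if $a$ is invertible. These form the category $\mathbf{FSch}$,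 and $F(A)$, with the sheaf $\mathcal O_A$, is an F-scheme. **Proposition.** For every F-scheme $X$ and every ring $A$, the natural map $$\mathrm{Hom}_{\mathbf{FSch}}(X,F(A))\to\mathrm{Hom}_{\mathbf{Rings}}(A,\Gamma(X,\mathcal O_X)),$$ which sends $f$ to the composite of $A\to\Gamma(F(A),\mathcal O_A)$, $a\mapsto(\mathcal S\mapsto \text{the image of }a\text{ in }A_{\mathcal S})$, with $f^\sharp\colon\Gamma(F(A),\mathcal O_A)\to\Gamma(X,\mathcal O_X)$, is a bijection. -/

import Mathlib

universe u

/-! All rings are associative and unital, not necessarily commutative. -/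

namespace FSch

noncomputable section

open CategoryTheory TopologicalSpace Opposite AlgebraicGeometry

/-! ### Universal localization of a ring at a subset -/

/-- The relations of the presentation
`A_S = ⟨A, {x_s}_{s ∈ S} | x_s s = s x_s = 1⟩`. -/
inductive LocRel {A : Type u} [Ring A] (S : Set A) :
    FreeAlgebra ℤ (A ⊕ S) → FreeAlgebra ℤ (A ⊕ S) → Prop
  | add (a b : A) : LocRel S (FreeAlgebra.ι ℤ (.inl (a + b)))
      (FreeAlgebra.ι ℤ (.inl a) + FreeAlgebra.ι ℤ (.inl b))
  | mul (a b : A) : LocRel S (FreeAlgebra.ι ℤ (.inl (a * b)))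
      (FreeAlgebra.ι ℤ (.inl a) * FreeAlgebra.ι ℤ (.inl b))
  | one : LocRel S (FreeAlgebra.ι ℤ (.inl 1)) 1
  | inv_mul (s : S) :
      LocRel S (FreeAlgebra.ι ℤ (.inr s) * FreeAlgebra.ι ℤ (.inl (s : A))) 1
  | mul_inv (s : S) :
      LocRel S (FreeAlgebra.ι ℤ (.inl (s : A)) * FreeAlgebra.ι ℤ (.inr s)) 1

/-- The localization `A_S` of a ring `A` at an arbitrary subset `S`. -/
def Loc {A : Type u} [Ring A] (S : Set A) : Type u := RingQuot (LocRel S)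

namespace Loc

variable {A : Type u} [Ring A] (S : Set A)

instance : Ring (Loc S) := inferInstanceAs (Ring (RingQuot (LocRel S)))

/-- The quotient map of the presentation. -/
def mk : FreeAlgebra ℤ (A ⊕ S) →+* Loc S := RingQuot.mkRingHom (LocRel S)

theorem mk_rel {x y : FreeAlgebra ℤ (A ⊕ S)} (h : LocRel S x y) : mk S x = mk S y :=
  RingQuot.mkRingHom_rel h

/-- The canonical homomorphism `i_S : A → A_S`. -/
def of : A →+* Loc S :=
  RingHom.mk' ⟨⟨fun a => mk S (FreeAlgebra.ι ℤ (.inl a)),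
    by rw [mk_rel S LocRel.one, map_one]⟩,
    fun a b => by
      change mk S (FreeAlgebra.ι ℤ (.inl (a * b))) = _
      rw [mk_rel S (LocRel.mul a b), map_mul]⟩
    fun a b => by
      change mk S (FreeAlgebra.ι ℤ (.inl (a + b))) = _
      rw [mk_rel S (LocRel.add a b), map_add]; rfl

theorem of_apply (a : A) : of S a = mk S (FreeAlgebra.ι ℤ (.inl a)) := rfl

theorem isUnit_of {s : A} (hs : s ∈ S) : IsUnit (of S s) := by
  refine ⟨⟨of S s, mk S (FreeAlgebra.ι ℤ (.inr ⟨s, hs⟩)), ?_, ?_⟩, rfl⟩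
  · rw [of_apply, ← map_mul, mk_rel S (LocRel.mul_inv ⟨s, hs⟩), map_one]
  · rw [of_apply, ← map_mul, mk_rel S (LocRel.inv_mul ⟨s, hs⟩), map_one]

variable {S} {B : Type*} [Ring B]

/-- The extension `φ_S : A_S → B` of a homomorphism `φ : A → B` that inverts `S`. -/
def lift (φ : A →+* B) (h : ∀ s ∈ S, IsUnit (φ s)) : Loc S →+* B :=
  RingQuot.lift
    ⟨((FreeAlgebra.lift ℤ (Sum.elim φ fun s : S => ((h s s.2).unit⁻¹ : Bˣ).1) :
        FreeAlgebra ℤ (A ⊕ S) →ₐ[ℤ] B) : FreeAlgebra ℤ (A ⊕ S) →+* B), by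
      intro x y hxy
      induction hxy <;> simp⟩

@[simp] theorem lift_of (φ : A →+* B) (h : ∀ s ∈ S, IsUnit (φ s)) (a : A) :
    lift φ h (of S a) = φ a := by
  rw [of_apply, lift, mk]
  erw [RingQuot.lift_mkRingHom_apply]
  simp

/-- Two homomorphisms out of `A_S` that agree on `A` are equal. -/
theorem hom_ext {f g : Loc S →+* B} (h : ∀ a, f (of S a) = g (of S a)) : f = g := by
  refine RingQuot.ringQuot_ext (r := LocRel S) f g (RingHom.toIntAlgHom_injective ?_)
  refine FreeAlgebra.hom_ext (funext ?_)
  rintro (a | s)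
  · exact h a
  · have hu : IsUnit (f (of S (s : A))) := (isUnit_of S s.2).map f
    refine hu.mul_left_cancel ?_
    have key : ∀ k : Loc S →+* B,
        k (of S (s : A)) * k (mk S (FreeAlgebra.ι ℤ (.inr s))) = 1 := fun k => by
      rw [of_apply, ← map_mul, ← map_mul, mk_rel S (LocRel.mul_inv s), map_one, map_one]
    calc f (of S (s : A)) * f (mk S (FreeAlgebra.ι ℤ (.inr s))) = 1 := key f
      _ = g (of S (s : A)) * g (mk S (FreeAlgebra.ι ℤ (.inr s))) := (key g).symm
      _ = f (of S (s : A)) * g (mk S (FreeAlgebra.ι ℤ (.inr s))) := by rw [h]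

end Loc

/-! ### Successive localizations -/

/-- Auxiliary simultaneous recursion for `Chain` and `Chain.ring`. -/
def chainAux (A : Type u) [Ring A] : ℕ → Σ P : Type u, P → RingCat.{u}
  | 0 => ⟨PUnit, fun _ => RingCat.of A⟩
  | n + 1 => ⟨Σ p : (chainAux A n).1, Set ((chainAux A n).2 p), fun q => RingCat.of (Loc q.2)⟩

/-- A finite sequence `(S₁, …, Sₙ)` of subsets `S₁ ⊆ A`, `S₂ ⊆ A_{S₁}`,
`S₃ ⊆ (A_{S₁})_{S₂}`, … -/
def Chain (A : Type u) [Ring A] (n : ℕ) : Type u := (chainAux A n).1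

namespace Chain

variable {A : Type u} [Ring A]

/-- The iterated localization `(…(A_{S₁})_{S₂}…)_{Sₙ}`. -/
def ring {n : ℕ} (p : Chain A n) : Type u := (chainAux A n).2 p

instance {n : ℕ} (p : Chain A n) : Ring p.ring :=
  inferInstanceAs (Ring ((chainAux A n).2 p))

/-- The empty sequence; its ring is `A`. -/
def nil : Chain A 0 := PUnit.unit

/-- `(S₁, …, Sₙ), S ↦ (S₁, …, Sₙ, S)`. -/
def snoc {n : ℕ} (p : Chain A n) (S : Set p.ring) : Chain A (n + 1) := Sigma.mk p S

/-- `(S₁, …, Sₙ, Sₙ₊₁) ↦ (S₁, …, Sₙ)`. -/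
def init {n : ℕ} (q : Chain A (n + 1)) : Chain A n := Sigma.fst q

/-- `(S₁, …, Sₙ, Sₙ₊₁) ↦ Sₙ₊₁`. -/
def last {n : ℕ} (q : Chain A (n + 1)) : Set q.init.ring := Sigma.snd q

/-- The ring of a chain of length `n + 1` is the localization at its last term. -/
theorem ring_succ {n : ℕ} (q : Chain A (n + 1)) : q.ring = Loc q.last := rfl

/-- The localization map from the ring of `(S₁, …, Sₙ)` to that of `(S₁, …, Sₙ₊₁)`. -/
def ofInit {n : ℕ} (q : Chain A (n + 1)) : q.init.ring →+* q.ring := Loc.of q.last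

/-- The homomorphism induced on `q.ring` by one on `q.init.ring` that inverts the last term. -/
def liftInit {n : ℕ} {B : Type*} [Ring B] (q : Chain A (n + 1)) (φ : q.init.ring →+* B)
    (h : ∀ s ∈ q.last, IsUnit (φ s)) : q.ring →+* B := Loc.lift φ h

/-- The canonical homomorphism from `A` to an iterated localization of `A`. -/
def ofBase : ∀ {n : ℕ} (p : Chain A n), A →+* p.ring
  | 0, _ => RingHom.id A
  | _ + 1, q => q.ofInit.comp (ofBase q.init)

/-- Containment `(S₁, …, Sₙ) ⊆ (T₁, …, Tₙ)`, together with the homomorphism that it induces on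
iterated localizations: at each step the image of `Sᵢ` under the homomorphism already
constructed lies in `Tᵢ`. -/
def sub : ∀ {n : ℕ} (p q : Chain A n), Σ' P : Prop, P → (p.ring →+* q.ring)
  | 0, _, _ => ⟨True, fun _ => RingHom.id A⟩
  | _ + 1, p, q =>
    ⟨∃ h : (sub p.init q.init).1, ∀ s ∈ p.last, (sub p.init q.init).2 h s ∈ q.last,
      fun h => p.liftInit (q.ofInit.comp ((sub p.init q.init).2 h.1))
        fun s hs => Loc.isUnit_of q.last (h.2 s hs)⟩

/-- `(S₁, …, Sₙ) ⊆ (T₁, …, Tₙ)`. -/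
def Sub {n : ℕ} (p q : Chain A n) : Prop := (sub p q).1

/-- The homomorphism of iterated localizations induced by a containment. -/
def Sub.hom {n : ℕ} {p q : Chain A n} (h : p.Sub q) : p.ring →+* q.ring := (sub p q).2 h

/-- All terms are singletons, `Sᵢ = {aᵢ}`: the chain is a tuple `(a₁, …, aₙ)` with `a₁ ∈ A`,
`a₂ ∈ A_{a₁}`, `a₃ ∈ (A_{a₁})_{a₂}`, … -/
def IsFraction : ∀ {n : ℕ} (_ : Chain A n), Prop
  | 0, _ => True
  | _ + 1, q => IsFraction q.init ∧ ∃ a, q.last = {a}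

theorem liftInit_ofInit {n : ℕ} {B : Type*} [Ring B] (q : Chain A (n + 1))
    (φ : q.init.ring →+* B) (h : ∀ s ∈ q.last, IsUnit (φ s)) (x : q.init.ring) :
    q.liftInit φ h (q.ofInit x) = φ x := Loc.lift_of φ h x

/-- `A → p.ring` is an epimorphism of rings. -/
theorem hom_ext {B : Type*} [Ring B] : ∀ {n : ℕ} {p : Chain A n} {f g : p.ring →+* B},
    (∀ a, f (p.ofBase a) = g (p.ofBase a)) → f = g
  | 0, _, _, _, h => RingHom.ext h
  | _ + 1, q, f, g, h => by
    have := hom_ext (p := q.init) (f := f.comp q.ofInit) (g := g.comp q.ofInit) h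
    exact Loc.hom_ext fun x => DFunLike.congr_fun this x

theorem Sub.hom_ofBase : ∀ {n : ℕ} {p q : Chain A n} (h : p.Sub q) (a : A),
    h.hom (p.ofBase a) = q.ofBase a
  | 0, _, _, _, _ => rfl
  | _ + 1, p, q, h, a => by
    have h' := fun s hs => Loc.isUnit_of q.last (h.2 s hs)
    refine (liftInit_ofInit p (q.ofInit.comp (Sub.hom (p := p.init) (q := q.init) h.1)) h'
      (p.init.ofBase a)).trans ?_
    exact congrArg q.ofInit (Sub.hom_ofBase (p := p.init) (q := q.init) h.1 a)

end Chain

/-- For `φ : A → B`, the first `n` terms of the system coming from `φ`, together with the induced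
homomorphism `φₙ : Aₙ → B`; here `Sₙ₊₁ = φₙ⁻¹(U(B))` and `Aₙ₊₁ = (Aₙ)_{Sₙ₊₁}`. -/
def tower {A : Type u} [Ring A] {B : Type u} [Ring B] (φ : A →+* B) :
    ∀ n : ℕ, Σ' p : Chain A n, p.ring →+* B
  | 0 => ⟨Chain.nil, φ⟩
  | n + 1 => ⟨(tower φ n).1.snoc {x | IsUnit ((tower φ n).2 x)},
      Chain.liftInit ((tower φ n).1.snoc {x | IsUnit ((tower φ n).2 x)}) (tower φ n).2
        fun _ hs => hs⟩

/-- The fully invertible system `(S₁, S₂, …)` coming from `φ : A → B`, as the sequence of its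
initial segments `(S₁, …, Sₙ)`. -/
def systemOf {A : Type u} [Ring A] {B : Type u} [Ring B] (φ : A →+* B) (n : ℕ) : Chain A n :=
  (tower φ n).1

/-- The full spectrum `F(A)`: the set of fully invertible systems on `A`, that is, of the
sequences coming from some homomorphism from `A` to a nonzero ring. -/
def FullSpec (A : Type u) [Ring A] : Type u :=
  {s : ∀ n, Chain A n //
    ∃ (B : Type u) (_ : Ring B) (_ : Nontrivial B) (φ : A →+* B), s = systemOf φ}

namespace FullSpec

variable {A : Type u} [Ring A]

/-- The initial segment `(S₁, …, Sₙ)` of `𝒮`. -/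
def seg (𝒮 : FullSpec A) (n : ℕ) : Chain A n := 𝒮.1 n

theorem init_seg (𝒮 : FullSpec A) (n : ℕ) : (𝒮.seg (n + 1)).init = 𝒮.seg n := by
  obtain ⟨_, B, _, _, φ, rfl⟩ := 𝒮
  rfl

/-- The localization map `A_{𝒮,n} → A_{𝒮,n+1} = (A_{𝒮,n})_{Sₙ₊₁}`. -/
def step (𝒮 : FullSpec A) (n : ℕ) : (𝒮.seg n).ring →+* (𝒮.seg (n + 1)).ring :=
  (init_seg 𝒮 n) ▸ (𝒮.seg (n + 1)).ofInit

theorem step_ofBase (𝒮 : FullSpec A) (n : ℕ) (a : A) :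
    𝒮.step n ((𝒮.seg n).ofBase a) = (𝒮.seg (n + 1)).ofBase a := by
  have key : ∀ (p : Chain A n) (q : Chain A (n + 1)) (h : q.init = p),
      (h ▸ q.ofInit : p.ring →+* q.ring) (p.ofBase a) = q.ofBase a := by
    rintro _ q rfl
    rfl
  exact key _ _ (init_seg 𝒮 n)

/-- The composite transition map `A_{𝒮,m} → A_{𝒮,n}` for `m ≤ n`. -/
def transition (𝒮 : FullSpec A) (m n : ℕ) (h : m ≤ n) : (𝒮.seg m).ring →+* (𝒮.seg n).ring :=
  Nat.leRec (motive := fun k _ => (𝒮.seg m).ring →+* (𝒮.seg k).ring) (RingHom.id _)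
    (fun k _ f => (𝒮.step k).comp f) h

theorem transition_ofBase (𝒮 : FullSpec A) (m n : ℕ) (h : m ≤ n) (a : A) :
    𝒮.transition m n h ((𝒮.seg m).ofBase a) = (𝒮.seg n).ofBase a := by
  induction n, h using Nat.le_induction with
  | base => simp [transition, Nat.leRec_self]
  | succ k hk ih =>
    rw [transition, Nat.leRec_succ (h1 := hk)]
    exact (congrArg (𝒮.step k) ih).trans (step_ofBase 𝒮 k a)

instance (𝒮 : FullSpec A) :
    DirectedSystem (fun n => (𝒮.seg n).ring) fun m n h => ⇑(𝒮.transition m n h) where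
  map_self i x := by simp [transition, Nat.leRec_self]
  map_map _ _ _ hij hjk x := by
    have : (𝒮.transition _ _ hjk).comp (𝒮.transition _ _ hij) = 𝒮.transition _ _ (hij.trans hjk) :=
      Chain.hom_ext fun a => by simp [transition_ofBase]
    exact DFunLike.congr_fun this x

/-- The localization `A_𝒮`, the direct limit of the rings `A_{𝒮,n}`. -/
def localization (𝒮 : FullSpec A) : Type u :=
  DirectLimit (fun n => (𝒮.seg n).ring) fun m n h => 𝒮.transition m n h

instance (𝒮 : FullSpec A) : Ring 𝒮.localization :=
  inferInstanceAs (Ring (DirectLimit (fun n => (𝒮.seg n).ring) fun m n h => 𝒮.transition m n h))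

/-- The canonical homomorphism `A_{𝒮,n} → A_𝒮`. -/
def ofSeg (𝒮 : FullSpec A) (n : ℕ) : (𝒮.seg n).ring →+* 𝒮.localization :=
  DirectLimit.Ring.of (fun n => (𝒮.seg n).ring) (fun m n h => 𝒮.transition m n h) n

/-- The canonical homomorphism `i_𝒮 : A → A_𝒮`. -/
def ofBase (𝒮 : FullSpec A) : A →+* 𝒮.localization := 𝒮.ofSeg 0

theorem ofSeg_ofBase (𝒮 : FullSpec A) (n : ℕ) (a : A) :
    𝒮.ofSeg n ((𝒮.seg n).ofBase a) = 𝒮.ofBase a := by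
  have h : 𝒮.transition 0 n n.zero_le a = (𝒮.seg n).ofBase a :=
    𝒮.transition_ofBase 0 n n.zero_le a
  rw [← h]
  exact DirectLimit.Ring.of_f (G := fun n => (𝒮.seg n).ring)
    (f := fun m n h => 𝒮.transition m n h) (i := 0) (j := n) n.zero_le a

end FullSpec

/-! ### Fractions, and the topology on the full spectrum -/

/-- A fraction `𝐚 = (a₁, …, aₙ)` of `A`: `a₁ ∈ A`, `a₂ ∈ A_{a₁}`, `a₃ ∈ (A_{a₁})_{a₂}`, …, encoded
by the chain `({a₁}, …, {aₙ})`. -/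
structure Fraction (A : Type u) [Ring A] where
  length : ℕ
  chain : Chain A length
  isFraction : chain.IsFraction

namespace Fraction

variable {A : Type u} [Ring A]

/-- The empty fraction. -/
def nil (A : Type u) [Ring A] : Fraction A := ⟨0, Chain.nil, trivial⟩

/-- The ring `A_𝐚 = (…(A_{a₁})_{a₂}…)_{aₙ}`. -/
def ring (a : Fraction A) : Type u := a.chain.ring

instance (a : Fraction A) : Ring a.ring := inferInstanceAs (Ring a.chain.ring)

/-- `𝐚 ∈ 𝒮`: each `aᵢ` lies in `Sᵢ`, via the homomorphism
`(…(A_{a₁})…)_{aᵢ₋₁} → (…(A_{S₁})…)_{Sᵢ₋₁}` provided by the previous conditions. -/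
def Mem (a : Fraction A) (𝒮 : FullSpec A) : Prop := a.chain.Sub (𝒮.seg a.length)

/-- For `𝐚 ∈ 𝒮`, the homomorphism `A_𝐚 → A_𝒮`. -/
def toLocalization (a : Fraction A) {𝒮 : FullSpec A} (h : a.Mem 𝒮) :
    a.ring →+* 𝒮.localization :=
  (𝒮.ofSeg a.length).comp (Chain.Sub.hom h)

/-- The fundamental subset `D(𝐚) = {𝒮 | 𝐚 ∈ 𝒮}`. -/
def basicSet (a : Fraction A) : Set (FullSpec A) := {𝒮 | a.Mem 𝒮}

theorem toLocalization_ofBase (a : Fraction A) {𝒮 : FullSpec A} (h : a.Mem 𝒮) (x : A) :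
    a.toLocalization h (a.chain.ofBase x) = 𝒮.ofBase x := by
  exact (congrArg (𝒮.ofSeg a.length) (Chain.Sub.hom_ofBase h x)).trans (𝒮.ofSeg_ofBase _ x)

theorem sub_systemOf_iff {B : Type u} [Ring B] (φ : A →+* B) : ∀ {n : ℕ} (p : Chain A n),
    p.Sub (systemOf φ n) ↔ ∃ g : p.ring →+* B, ∀ x, g (p.ofBase x) = φ x := by
  have base : ∀ (n : ℕ) (x : A), (tower φ n).2 ((tower φ n).1.ofBase x) = φ x := by
    intro n x
    induction n with
    | zero => rfl
    | succ n ih =>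
      exact (Chain.liftInit_ofInit ((tower φ n).1.snoc {x | IsUnit ((tower φ n).2 x)})
        (tower φ n).2 (fun _ hs => hs) _).trans ih
  have mp : ∀ {n : ℕ} {p : Chain A n} (h : p.Sub (systemOf φ n)) (x : A),
      (tower φ n).2 (Chain.Sub.hom h (p.ofBase x)) = φ x := fun {n p} h x => by
    rw [Chain.Sub.hom_ofBase h x]
    exact base n x
  intro n
  induction n with
  | zero => exact fun p => ⟨fun _ => ⟨φ, fun _ => rfl⟩, fun _ => trivial⟩
  | succ n ih =>
    refine fun p => ⟨fun h => ⟨(tower φ (n + 1)).2.comp (Chain.Sub.hom h), mp h⟩, ?_⟩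
    rintro ⟨g, hg⟩
    have h : p.init.Sub (systemOf φ n) := (ih p.init).2 ⟨g.comp p.ofInit, hg⟩
    refine ⟨h, fun s hs => ?_⟩
    have e : (tower φ n).2.comp h.hom = g.comp p.ofInit :=
      Chain.hom_ext fun x => (mp h x).trans (hg x).symm
    change IsUnit (((tower φ n).2.comp h.hom) s)
    rw [e]
    exact (Loc.isUnit_of p.last hs).map g

/-- Any two fractions have a common refinement. -/
theorem exists_chain_refinement : ∀ {n : ℕ} (p : Chain A n), p.IsFraction → ∀ {m : ℕ}
    (q : Chain A m), q.IsFraction → ∃ c : Chain A (m + n), c.IsFraction ∧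
      ∃ (f : p.ring →+* c.ring) (g : q.ring →+* c.ring),
        (∀ x, f (p.ofBase x) = c.ofBase x) ∧ (∀ x, g (q.ofBase x) = c.ofBase x) ∧
        ∀ (T : Type u) [Ring T] (f' : p.ring →+* T) (g' : q.ring →+* T),
          (∀ x, f' (p.ofBase x) = g' (q.ofBase x)) →
          ∃ h : c.ring →+* T, ∀ x, h (c.ofBase x) = g' (q.ofBase x)
  | 0, p, _, _, q, hq => ⟨q, hq, q.ofBase, RingHom.id _, fun _ => rfl, fun _ => rfl,
      fun _ _ _ g' _ => ⟨g', fun _ => rfl⟩⟩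
  | n + 1, p, ⟨hp, a, ha⟩, m, q, hq => by
    obtain ⟨c, hc, f, g, hf, hg, huniv⟩ := exists_chain_refinement p.init hp q hq
    let d : Chain A (m + n + 1) := c.snoc {f a}
    have hu : ∀ s ∈ p.last, IsUnit ((d.ofInit.comp f) s) := by
      intro s hs
      rw [ha, Set.mem_singleton_iff] at hs
      subst hs
      exact Loc.isUnit_of d.last (Set.mem_singleton _)
    refine ⟨d, ⟨hc, f a, rfl⟩, p.liftInit (d.ofInit.comp f) hu, d.ofInit.comp g,
      fun x => ?_, fun x => ?_, fun T _ f' g' hfg => ?_⟩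
    · refine (p.liftInit_ofInit _ hu (p.init.ofBase x)).trans ?_
      exact congrArg d.ofInit (hf x)
    · exact congrArg d.ofInit (hg x)
    · obtain ⟨h, hh⟩ := huniv T (f'.comp p.ofInit) g' hfg
      have e : h.comp f = f'.comp p.ofInit := Chain.hom_ext fun x => by
        rw [RingHom.comp_apply, hf, hh]
        exact (hfg x).symm
      have hd : ∀ s ∈ d.last, IsUnit (h s) := by
        intro s hs
        obtain rfl : s = f a := hs
        change IsUnit ((h.comp f) a)
        rw [e]
        exact (Loc.isUnit_of p.last (ha ▸ Set.mem_singleton a)).map f'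
      exact ⟨d.liftInit h hd, fun x => (d.liftInit_ofInit h hd _).trans (hh x)⟩

theorem exists_refinement (a b : Fraction A) : ∃ (c : Fraction A) (f : a.ring →+* c.ring)
    (g : b.ring →+* c.ring), ∀ (𝒮 : FullSpec A) (ha : a.Mem 𝒮) (hb : b.Mem 𝒮),
      ∃ hc : c.Mem 𝒮, (∀ x, c.toLocalization hc (f x) = a.toLocalization ha x) ∧
        ∀ y, c.toLocalization hc (g y) = b.toLocalization hb y := by
  obtain ⟨c, hc, f, g, hf, hg, huniv⟩ :=
    exists_chain_refinement a.chain a.isFraction b.chain b.isFraction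
  refine ⟨⟨_, c, hc⟩, f, g, fun 𝒮 ha hb => ?_⟩
  have hmem : (⟨_, c, hc⟩ : Fraction A).Mem 𝒮 := by
    obtain ⟨_, B, _, _, φ, rfl⟩ := 𝒮
    obtain ⟨f', hf'⟩ := (sub_systemOf_iff φ a.chain).1 ha
    obtain ⟨g', hg'⟩ := (sub_systemOf_iff φ b.chain).1 hb
    obtain ⟨h, hh⟩ := huniv B f' g' fun x => (hf' x).trans (hg' x).symm
    exact (sub_systemOf_iff φ c).2 ⟨h, fun x => (hh x).trans (hg' x)⟩
  refine ⟨hmem, DFunLike.congr_fun (f := (toLocalization _ hmem).comp f) ?_,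
    DFunLike.congr_fun (f := (toLocalization _ hmem).comp g) ?_⟩
  · exact Chain.hom_ext fun x => (congrArg (toLocalization _ hmem) (hf x)).trans
      ((toLocalization_ofBase _ hmem x).trans (toLocalization_ofBase a ha x).symm)
  · exact Chain.hom_ext fun x => (congrArg (toLocalization _ hmem) (hg x)).trans
      ((toLocalization_ofBase _ hmem x).trans (toLocalization_ofBase b hb x).symm)

end Fraction

/-- The topology on `F(A)` generated by the fundamental subsets `D(𝐚)`. -/
instance (A : Type u) [Ring A] : TopologicalSpace (FullSpec A) :=
  TopologicalSpace.generateFrom (Set.range Fraction.basicSet)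

/-! ### The structure sheaf -/

section StructureSheaf

variable (A : Type u) [Ring A]

/-- The full spectrum as an object of `TopCat`. -/
def specTop : TopCat.{u} := TopCat.of (FullSpec A)

variable {A} in
/-- A point of `specTop A`, as a fully invertible system. -/
def point (x : specTop A) : FullSpec A := x

/-- The localization `A_𝒮` at a point of `specTop A`. -/
abbrev specLoc (x : specTop A) : Type u := (point x).localization

/-- A function `t(𝒮) ∈ A_𝒮` on an open set `U` is given on the whole of `U` by one element
`b ∈ A_𝐚`, for a fraction `𝐚` that belongs to every point of `U`. -/
def isFractionPrelocal : TopCat.PrelocalPredicate (specLoc A) where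
  pred {U} t := ∃ (a : Fraction A) (b : a.ring), ∀ 𝒮 : U, ∃ h : a.Mem (point 𝒮.1),
    t 𝒮 = a.toLocalization h b
  res := by
    rintro V U i t ⟨a, b, w⟩
    exact ⟨a, b, fun 𝒮 => w (i 𝒮)⟩

/-- The functions that are locally given by elements of rings `A_𝐚`. -/
def isLocallyFraction : TopCat.LocalPredicate (specLoc A) := (isFractionPrelocal A).sheafify

/-- The sections of the structure sheaf over `U`, as a subring of the ring of all functions
`t(𝒮) ∈ A_𝒮`. -/
def sections (U : Opens (specTop A)) : Subring (∀ 𝒮 : U, specLoc A 𝒮.1) where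
  carrier := {t | (isLocallyFraction A).pred t}
  zero_mem' x := ⟨U, x.2, 𝟙 _, Fraction.nil A, 0, fun _ => ⟨trivial, (map_zero _).symm⟩⟩
  one_mem' x := ⟨U, x.2, 𝟙 _, Fraction.nil A, 1, fun _ => ⟨trivial, (map_one _).symm⟩⟩
  neg_mem' {t} ht x := by
    obtain ⟨V, m, i, a, b, w⟩ := ht x
    refine ⟨V, m, i, a, -b, fun 𝒮 => ?_⟩
    obtain ⟨h, e⟩ := w 𝒮
    exact ⟨h, (congrArg Neg.neg e).trans (map_neg _ _).symm⟩
  add_mem' {s t} hs ht x := by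
    obtain ⟨V, m, i, a, b, w⟩ := hs x
    obtain ⟨V', m', i', a', b', w'⟩ := ht x
    obtain ⟨c, f, g, hc⟩ := Fraction.exists_refinement a a'
    refine ⟨V ⊓ V', ⟨m, m'⟩, Opens.infLELeft _ _ ≫ i, c, f b + g b', fun 𝒮 => ?_⟩
    obtain ⟨h, e⟩ := w ⟨𝒮.1, 𝒮.2.1⟩
    obtain ⟨h', e'⟩ := w' ⟨𝒮.1, 𝒮.2.2⟩
    obtain ⟨h₀, e₁, e₂⟩ := hc (point 𝒮.1) h h'
    refine ⟨h₀, ?_⟩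
    rw [map_add, e₁, e₂, ← e, ← e']
    rfl
  mul_mem' {s t} hs ht x := by
    obtain ⟨V, m, i, a, b, w⟩ := hs x
    obtain ⟨V', m', i', a', b', w'⟩ := ht x
    obtain ⟨c, f, g, hc⟩ := Fraction.exists_refinement a a'
    refine ⟨V ⊓ V', ⟨m, m'⟩, Opens.infLELeft _ _ ≫ i, c, f b * g b', fun 𝒮 => ?_⟩
    obtain ⟨h, e⟩ := w ⟨𝒮.1, 𝒮.2.1⟩
    obtain ⟨h', e'⟩ := w' ⟨𝒮.1, 𝒮.2.2⟩
    obtain ⟨h₀, e₁, e₂⟩ := hc (point 𝒮.1) h h'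
    refine ⟨h₀, ?_⟩
    rw [map_mul, e₁, e₂, ← e, ← e']
    rfl

/-- The structure presheaf `𝒪_A` on `F(A)`: sections over `U`, with restriction of functions. -/
def structurePresheaf : TopCat.Presheaf RingCat.{u} (specTop A) where
  obj U := RingCat.of (sections A U.unop)
  map {U V} i := RingCat.ofHom
    { toFun := fun t => ⟨fun 𝒮 => t.1 (i.unop 𝒮), (isLocallyFraction A).res i.unop t.1 t.2⟩
      map_one' := rfl
      map_mul' := fun _ _ => rfl
      map_zero' := rfl
      map_add' := fun _ _ => rfl }

theorem structurePresheaf_isSheaf : (structurePresheaf A).IsSheaf := by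
  refine (TopCat.Presheaf.isSheaf_iff_isSheaf_comp (forget RingCat) _).2 ?_
  refine TopCat.Presheaf.isSheaf_of_iso ?_ (TopCat.subsheafToTypes (isLocallyFraction A)).2
  exact NatIso.ofComponents fun _ => Iso.refl _

/-- The ringed space `(F(A), 𝒪_A)`. -/
def specSpace : SheafedSpace RingCat.{u} where
  carrier := specTop A
  presheaf := structurePresheaf A
  IsSheaf := structurePresheaf_isSheaf A

/-- The canonical homomorphism `A → Γ(F(A), 𝒪_A)`, sending `a` to the section `𝒮 ↦ i_𝒮(a)`. -/
def toGlobalSections : RingCat.of A ⟶ (specSpace A).presheaf.obj (op ⊤) :=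
  RingCat.ofHom
    { toFun := fun a => (⟨fun 𝒮 => (point 𝒮.1).ofBase a, fun x =>
        ⟨⊤, x.2, 𝟙 _, Fraction.nil A, a, fun _ => ⟨trivial, rfl⟩⟩⟩ : sections A ⊤)
      map_one' := Subtype.ext (funext fun _ => map_one _)
      map_mul' := fun _ _ => Subtype.ext (funext fun _ => map_mul _ _ _)
      map_zero' := Subtype.ext (funext fun _ => map_zero _)
      map_add' := fun _ _ => Subtype.ext (funext fun _ => map_add _ _ _) }

end StructureSheaf

/-! ### F-schemes -/

/-- An F-scheme: a ringed space each point of which has an open neighbourhood that is isomorphic,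
as a ringed space, to `(F(R), 𝒪_R)` for some ring `R`. -/
structure FScheme extends SheafedSpace RingCat.{u} where
  locally_affine : ∀ x : carrier, ∃ U : Opens carrier, x ∈ U ∧ ∃ (R : Type u) (_ : Ring R),
    Nonempty (toSheafedSpace.restrict U.isOpenEmbedding ≅ specSpace R)

namespace FScheme

/-- A morphism of F-schemes: a morphism `(f, f^♯)` of ringed spaces such that each
`𝒪_{Y,f(x)} → 𝒪_{X,x}` is local, i.e. reflects invertibility. -/
structure Hom (X Y : FScheme.{u}) : Type u
    extends X.toPresheafedSpace.Hom Y.toPresheafedSpace where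
  isLocal : ∀ x, IsLocalHom (toHom.stalkMap x).hom

theorem Hom.ext_toHom {X Y : FScheme.{u}} {f g : Hom X Y} (h : f.toHom = g.toHom) : f = g := by
  cases f; cases g; congr

instance : Category FScheme.{u} where
  Hom := Hom
  id X := ⟨𝟙 X.toPresheafedSpace, fun x => by
    erw [PresheafedSpace.stalkMap.id]
    exact ⟨fun _ h => h⟩⟩
  comp {X Y Z} f g := ⟨(f.toHom ≫ g.toHom : X.toPresheafedSpace ⟶ Z.toPresheafedSpace), fun x => by
    erw [PresheafedSpace.stalkMap.comp]
    exact ⟨fun a h => (g.isLocal _).map_nonunit a ((f.isLocal x).map_nonunit _ h)⟩⟩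
  id_comp {X Y} f := Hom.ext_toHom
    (Category.id_comp (obj := PresheafedSpace RingCat.{u}) (X := X.toPresheafedSpace)
      (Y := Y.toPresheafedSpace) f.toHom)
  comp_id {X Y} f := Hom.ext_toHom
    (Category.comp_id (obj := PresheafedSpace RingCat.{u}) (X := X.toPresheafedSpace)
      (Y := Y.toPresheafedSpace) f.toHom)
  assoc {W X Y Z} f g h := Hom.ext_toHom
    (Category.assoc (obj := PresheafedSpace RingCat.{u}) (W := W.toPresheafedSpace)
      (X := X.toPresheafedSpace) (Y := Y.toPresheafedSpace) (Z := Z.toPresheafedSpace)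
      f.toHom g.toHom h.toHom)

/-- The affine F-scheme `F(A)`. -/
def affine (A : Type u) [Ring A] : FScheme.{u} where
  toSheafedSpace := specSpace A
  locally_affine _ := ⟨⊤, trivial, A, inferInstance, ⟨(specSpace A).restrictTopIso⟩⟩

/-- The ring `Γ(X, 𝒪_X)` of global sections. -/
def globalSections (X : FScheme.{u}) : RingCat.{u} := X.presheaf.obj (op ⊤)

/-- The homomorphism `f^♯ : Γ(Y, 𝒪_Y) → Γ(X, 𝒪_X)` of a morphism `f : X → Y`. -/
def Hom.onGlobalSections {X Y : FScheme.{u}} (f : Hom X Y) : Y.globalSections ⟶ X.globalSections :=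
  f.c.app (op ⊤)

/-- The natural map `Hom(X, F(A)) → Hom(A, Γ(X, 𝒪_X))`: it sends `f` to the composite
`A → Γ(F(A), 𝒪_A) → Γ(X, 𝒪_X)`. -/
def homToRingHom (X : FScheme.{u}) (A : Type u) [Ring A] (f : X ⟶ affine A) :
    A →+* X.globalSections :=
  (toGlobalSections A ≫ Hom.onGlobalSections (X := X) (Y := affine A) f).hom

end FScheme

end

end FSch

/-! A point of `F(A)` is a class of homomorphisms from `A` to nonzero rings, and composing with a
local homomorphism does not change the class (`FullSpec.ofHom_comp`). Each class has a canonical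
member `A → A_𝒮`: if `φ : A → B` has system `𝒮`, then `φ` factors through a local homomorphism `A_𝒮
→ B` (`FullSpec.isLocalHom_toTarget`). Membership of a fraction is an extension property: `𝐚`
belongs to the system of `φ` iff `φ` extends to `A_𝐚` (`Fraction.mem_ofHom_iff`). The extension is
unique, because `A → A_𝐚` is an epimorphism.

Surjectivity. Given `ρ : A → Γ(X, 𝒪_X)`, let `f(x)` be the system of `A → 𝒪_{X,x}`, a stalk of `X`
being nonzero. A fraction has finitely many terms and invertibility of a germ spreads to a
neighbourhood, so an extension to `A_𝐚` at `x` spreads as well (`exists_chain_extension`). This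
makes `f` continuous, and it shows that the germs `t(f(x)) ∈ A_{f(x)} → 𝒪_{X,x}` of a section `t`
glue. The stalk maps obtained are composites `𝒪_{A,f(x)} → A_{f(x)} → 𝒪_{X,x}` of local
homomorphisms, hence local.

Injectivity. For a morphism `f`, the map `A → 𝒪_{A,f(x)}` has system `f(x)` (`ofHom_toStalk`), and
the stalk map is local, so `f(x)` is the system of `A → 𝒪_{X,x}` (`FScheme.base_eq_pointMap`). The
sheaf map is then determined because sections come locally from rings `A_𝐚`, on which homomorphisms
are determined by their restrictions to `A` (`FScheme.sheafHom_ext`). -/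

namespace FSch

noncomputable section

open CategoryTheory TopologicalSpace Opposite AlgebraicGeometry

/-! ### Fully invertible systems and local homomorphisms -/

section Algebra

variable {A : Type u} [Ring A] {B : Type u} [Ring B]

theorem tower_ofBase (φ : A →+* B) (n : ℕ) (a : A) :
    (tower φ n).2 ((systemOf φ n).ofBase a) = φ a := by
  induction n with
  | zero => rfl
  | succ n ih =>
    exact (Chain.liftInit_ofInit ((tower φ n).1.snoc {x | IsUnit ((tower φ n).2 x)})
      (tower φ n).2 (fun _ hs => hs) _).trans ih

/-- A local `ψ` reflects units, so at each stage `ψ ∘ φₙ` and `φₙ` invert the same elements. -/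
theorem tower_comp {C : Type u} [Ring C] (ψ : B →+* C) [IsLocalHom ψ] (φ : A →+* B) (n : ℕ) :
    tower (ψ.comp φ) n = ⟨(tower φ n).1, ψ.comp (tower φ n).2⟩ := by
  induction n with
  | zero => rfl
  | succ n ih =>
    -- The induction hypothesis is an equality of dependent pairs; replacing the pair by a variable
    -- `t` allows substitution.
    have key : ∀ (p : Chain A n) (g : p.ring →+* B) (t : Σ' p : Chain A n, p.ring →+* C),
        t = ⟨p, ψ.comp g⟩ →
        (⟨t.1.snoc {x | IsUnit (t.2 x)},
          Chain.liftInit (t.1.snoc {x | IsUnit (t.2 x)}) t.2 fun _ hs => hs⟩ :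
          Σ' p : Chain A (n + 1), p.ring →+* C) =
        ⟨p.snoc {x | IsUnit (g x)},
          ψ.comp (Chain.liftInit (p.snoc {x | IsUnit (g x)}) g fun _ hs => hs)⟩ := by
      rintro p g _ rfl
      have hS : {x | IsUnit ((ψ.comp g) x)} = {x | IsUnit (g x)} :=
        Set.ext fun x => isUnit_map_iff ψ (g x)
      -- The two unit sets are only propositionally equal, and the localization depends on the set,
      -- so it too becomes a variable.
      have aux : ∀ (S : Set p.ring) (hS : S = {x | IsUnit (g x)})
          (h : ∀ s ∈ (p.snoc S).last, IsUnit ((ψ.comp g) s)),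
          (⟨p.snoc S, Chain.liftInit (p.snoc S) (ψ.comp g) h⟩ :
            Σ' p : Chain A (n + 1), p.ring →+* C) =
          ⟨p.snoc {x | IsUnit (g x)},
            ψ.comp (Chain.liftInit (p.snoc {x | IsUnit (g x)}) g fun _ hs => hs)⟩ := by
        rintro _ rfl h
        congr 1
        refine Loc.hom_ext fun x => ?_
        refine ((p.snoc _).liftInit_ofInit (ψ.comp g) h x).trans ?_
        exact congrArg ψ ((p.snoc {x | IsUnit (g x)}).liftInit_ofInit g (fun _ hs => hs) x).symm
      exact aux _ hS _
    exact key _ _ _ ih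

theorem systemOf_comp {C : Type u} [Ring C] (ψ : B →+* C) [IsLocalHom ψ] (φ : A →+* B) :
    systemOf (ψ.comp φ) = systemOf φ :=
  funext fun n => congrArg PSigma.fst (tower_comp ψ φ n)

namespace FullSpec

/-- The fully invertible system of a homomorphism to a nonzero ring, as a point of `F(A)`. -/
def ofHom [Nontrivial B] (φ : A →+* B) : FullSpec A :=
  ⟨systemOf φ, B, inferInstance, inferInstance, φ, rfl⟩

theorem exists_eq_ofHom (𝒮 : FullSpec A) : ∃ (B : Type u) (_ : Ring B) (_ : Nontrivial B)
    (φ : A →+* B), 𝒮 = ofHom φ := by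
  obtain ⟨_, B, _, _, φ, rfl⟩ := 𝒮
  exact ⟨B, _, ‹_›, φ, rfl⟩

theorem ofHom_comp [Nontrivial B] {C : Type u} [Ring C] [Nontrivial C] (ψ : B →+* C)
    [IsLocalHom ψ] (φ : A →+* B) : ofHom (ψ.comp φ) = ofHom φ :=
  Subtype.ext (systemOf_comp ψ φ)

theorem exists_ofSeg (𝒮 : FullSpec A) (y : 𝒮.localization) :
    ∃ (n : ℕ) (x : (𝒮.seg n).ring), 𝒮.ofSeg n x = y := by
  induction y using DirectLimit.induction with
  | _ i x => exact ⟨i, x, rfl⟩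

theorem ofSeg_step (𝒮 : FullSpec A) (n : ℕ) (x : (𝒮.seg n).ring) :
    𝒮.ofSeg (n + 1) (𝒮.step n x) = 𝒮.ofSeg n x := by
  have : (𝒮.ofSeg (n + 1)).comp (𝒮.step n) = 𝒮.ofSeg n := Chain.hom_ext fun a => by
    rw [RingHom.comp_apply, step_ofBase, ofSeg_ofBase, ofSeg_ofBase]
  exact DFunLike.congr_fun this x

variable [Nontrivial B] (φ : A →+* B)

/-- The homomorphism `A_{𝒮,n} → B` induced by `φ : A → B`, for `𝒮` the system of `φ`. -/
def segToTarget (n : ℕ) : ((ofHom φ).seg n).ring →+* B := (tower φ n).2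

theorem segToTarget_ofBase (n : ℕ) (a : A) :
    segToTarget φ n (((ofHom φ).seg n).ofBase a) = φ a := tower_ofBase φ n a

/-- The homomorphism `A_𝒮 → B` induced by `φ : A → B`, for `𝒮` the system of `φ`. -/
def toTarget : (ofHom φ).localization →+* B :=
  DirectLimit.Ring.lift (fun n => ((ofHom φ).seg n).ring)
    (fun m n h => (ofHom φ).transition m n h) B (segToTarget φ) fun m n h x => by
      have : (segToTarget φ n).comp ((ofHom φ).transition m n h) = segToTarget φ m :=
        Chain.hom_ext fun a => by
          rw [RingHom.comp_apply, transition_ofBase, segToTarget_ofBase, segToTarget_ofBase]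
      exact DFunLike.congr_fun this x

/-- Such an `x` lies in `Sₙ₊₁` by definition, so it is inverted one stage later. As every element of
`A_𝒮` comes from a finite stage, `A_𝒮 → B` is local. -/
theorem isUnit_ofSeg (n : ℕ) (x : ((ofHom φ).seg n).ring)
    (h : IsUnit (segToTarget φ n x)) : IsUnit ((ofHom φ).ofSeg n x) := by
  rw [← ofSeg_step]
  exact (Loc.isUnit_of {x | IsUnit ((tower φ n).2 x)} h).map ((ofHom φ).ofSeg (n + 1))

instance isLocalHom_toTarget : IsLocalHom (toTarget φ) where
  map_nonunit y hy := by
    obtain ⟨n, x, rfl⟩ := exists_ofSeg _ y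
    exact isUnit_ofSeg φ n x hy

instance (𝒮 : FullSpec A) : Nontrivial 𝒮.localization := by
  obtain ⟨B, _, _, φ, rfl⟩ := 𝒮.exists_eq_ofHom
  exact (toTarget φ).domain_nontrivial

/-- Any `φ` defining `𝒮` is `A → A_𝒮` followed by a local homomorphism, so both have the same
system. -/
theorem ofHom_ofBase (𝒮 : FullSpec A) : ofHom 𝒮.ofBase = 𝒮 := by
  obtain ⟨B, _, _, φ, rfl⟩ := 𝒮.exists_eq_ofHom
  exact (ofHom_comp (toTarget φ) (ofHom φ).ofBase).symm

end FullSpec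

/-! ### Fractions and extensions of homomorphisms -/

namespace Fraction

open FullSpec

variable [Nontrivial B]

theorem mem_ofHom_iff (a : Fraction A) (φ : A →+* B) :
    a.Mem (ofHom φ) ↔ ∃ g : a.ring →+* B, ∀ x, g (a.chain.ofBase x) = φ x :=
  sub_systemOf_iff φ a.chain

theorem mem_iff (a : Fraction A) (𝒮 : FullSpec A) :
    a.Mem 𝒮 ↔ ∃ g : a.ring →+* 𝒮.localization, ∀ x, g (a.chain.ofBase x) = 𝒮.ofBase x := by
  have := a.mem_ofHom_iff 𝒮.ofBase
  rwa [ofHom_ofBase] at this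

/-- Both maps `A_𝐚 → B` restrict to `φ`, and `A → A_𝐚` is an epimorphism. This compares values in
`A_𝒮` with an extension of `φ` obtained otherwise. -/
theorem toTarget_toLocalization (a : Fraction A) (φ : A →+* B) (h : a.Mem (ofHom φ))
    (g : a.ring →+* B) (hg : ∀ x, g (a.chain.ofBase x) = φ x) (b : a.ring) :
    toTarget φ (a.toLocalization h b) = g b := by
  have : (toTarget φ).comp (a.toLocalization h) = g := Chain.hom_ext fun x => by
    refine Eq.trans ?_ (hg x).symm
    exact congrArg (toTarget φ) (a.toLocalization_ofBase h x)
  exact DFunLike.congr_fun this b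

/-- If `b ∈ A_𝐚` is invertible in `A_𝒮` for some `𝒮 ∋ 𝐚`, then it is invertible in `A_𝐜` for a
fraction `𝐜 ∈ 𝒮` that extends `𝐚`. -/
theorem exists_isUnit_of_isUnit_toLocalization (a : Fraction A) {𝒮 : FullSpec A} (h : a.Mem 𝒮)
    (b : a.ring) (hb : IsUnit (a.toLocalization h b)) :
    ∃ (c : Fraction A) (f : a.ring →+* c.ring), IsUnit (f b) ∧ c.Mem 𝒮 ∧
      ∀ x, f (a.chain.ofBase x) = c.chain.ofBase x := by
  -- Append `b` to `𝐚`. The result belongs to `𝒮` because `A_𝐚 → A_𝒮` inverts `b` and so extends.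
  let q : Chain A (a.length + 1) := a.chain.snoc {b}
  let c : Fraction A := ⟨a.length + 1, q, a.isFraction, b, rfl⟩
  refine ⟨c, q.ofInit, Loc.isUnit_of q.last (Set.mem_singleton b), ?_, fun _ => rfl⟩
  refine (c.mem_iff _).2 ⟨q.liftInit (a.toLocalization h) ?_, fun x => ?_⟩
  · rintro s hs
    have e : s = b := hs
    exact (congrArg (fun y => IsUnit (a.toLocalization h y)) e).mpr hb
  · exact (q.liftInit_ofInit _ _ (a.chain.ofBase x)).trans (a.toLocalization_ofBase h x)

/-- A homomorphism `A_𝐚 → A_𝐜` under `A` commutes with the maps to `A_𝒮`. -/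
theorem toLocalization_comp {a c : Fraction A} {𝒮 : FullSpec A} (ha : a.Mem 𝒮) (hc : c.Mem 𝒮)
    (f : a.ring →+* c.ring) (hf : ∀ x, f (a.chain.ofBase x) = c.chain.ofBase x) (b : a.ring) :
    c.toLocalization hc (f b) = a.toLocalization ha b := by
  have : (c.toLocalization hc).comp f = a.toLocalization ha := Chain.hom_ext fun x => by
    refine Eq.trans (congrArg (c.toLocalization hc) (hf x)) ?_
    exact (c.toLocalization_ofBase hc x).trans (a.toLocalization_ofBase ha x).symm
  exact DFunLike.congr_fun this b

theorem isOpen_basicSet (a : Fraction A) : IsOpen a.basicSet :=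
  isOpen_generateFrom_of_mem ⟨a, rfl⟩

end Fraction

end Algebra

/-! ### Germs, invertibility and gluing for sheaves of rings -/

section Sheaf

variable {T : TopCat.{u}} (F : TopCat.Presheaf RingCat.{u} T)

/-- The inverse germ is the germ of a section `t`. The identities `st = 1` and `ts = 1`, both needed
without commutativity, each hold near `x`, hence together on an intersection. -/
theorem exists_isUnit_res_of_isUnit_germ {U : Opens T} {x : T} (hx : x ∈ U) (s : F.obj (op U))
    (h : IsUnit ((F.germ U x hx).hom s)) :
    ∃ (V : Opens T) (i : V ⟶ U), x ∈ V ∧ IsUnit ((F.map i.op).hom s) := by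
  obtain ⟨⟨_, v, huv, hvu⟩, rfl⟩ := h
  obtain ⟨W, hW, m, t, rfl⟩ := F.exists_le_germ_eq v hx
  have e : ∀ {W' : Opens T} (i : W' ⟶ W) (hx' : x ∈ W') (y : F.obj (op W)),
      F.germ W x m y = F.germ W' x hx' (F.map i.op y) := fun i hx' y =>
    (F.germ_res_apply i x hx' y).symm
  have h₁ : F.germ W x m ((F.map (homOfLE hW).op).hom s * t) = F.germ W x m 1 := by
    rw [map_mul, map_one, ← huv]
    exact congrArg (· * _) (F.germ_res_apply (homOfLE hW) x m s)
  have h₂ : F.germ W x m (t * (F.map (homOfLE hW).op).hom s) = F.germ W x m 1 := by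
    rw [map_mul, map_one, ← hvu]
    exact congrArg (_ * ·) (F.germ_res_apply (homOfLE hW) x m s)
  obtain ⟨V₁, m₁, i₁, j₁, e₁⟩ := F.germ_eq x m m _ _ h₁
  obtain ⟨V₂, m₂, i₂, j₂, e₂⟩ := F.germ_eq x m m _ _ h₂
  obtain rfl : i₁ = j₁ := Subsingleton.elim _ _
  obtain rfl : i₂ = j₂ := Subsingleton.elim _ _
  let k₁ : V₁ ⊓ V₂ ⟶ V₁ := Opens.infLELeft _ _
  let k₂ : V₁ ⊓ V₂ ⟶ V₂ := Opens.infLERight _ _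
  have res : ∀ {P Q R : Opens T} (k : R ⟶ Q) (i : Q ⟶ P) (y : F.obj (op P)),
      (F.map k.op).hom ((F.map i.op).hom y) = (F.map (k ≫ i).op).hom y := fun k i y => by
    rw [op_comp, F.map_comp]; rfl
  have e₁' := congrArg (F.map k₁.op).hom e₁
  have e₂' := congrArg (F.map k₂.op).hom e₂
  change (F.map k₁.op).hom ((F.map i₁.op).hom _) = (F.map k₁.op).hom ((F.map i₁.op).hom _) at e₁'
  change (F.map k₂.op).hom ((F.map i₂.op).hom _) = (F.map k₂.op).hom ((F.map i₂.op).hom _) at e₂'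
  rw [res, res, map_mul, map_one, res] at e₁' e₂'
  exact ⟨V₁ ⊓ V₂, (k₁ ≫ i₁) ≫ homOfLE hW, ⟨m₁, m₂⟩, ⟨_, _, e₁', e₂'⟩, rfl⟩

variable {F}

theorem section_eq_of_germ_eq (hF : F.IsSheaf) {U : Opens T} {s t : F.obj (op U)}
    (h : ∀ (x : T) (hx : x ∈ U), (F.germ U x hx).hom s = (F.germ U x hx).hom t) : s = t :=
  TopCat.Presheaf.section_ext ⟨F, hF⟩ U s t h

/-- A family of elements of stalks of a sheaf that locally is a family of germs of sections is the
family of germs of a section. -/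
theorem exists_section_of_germs (hF : F.IsSheaf) {U : Opens T} (σ : ∀ x : T, F.stalk x)
    (h : ∀ x ∈ U, ∃ (V : Opens T) (_ : V ≤ U) (s : F.obj (op V)), x ∈ V ∧
      ∀ (y : T) (hy : y ∈ V), (F.germ V y hy).hom s = σ y) :
    ∃ s : F.obj (op U), ∀ (x : T) (hx : x ∈ U), (F.germ U x hx).hom s = σ x := by
  choose! V hV s hx hs using h
  have hV' : ∀ x : U, V x.1 ≤ U := fun x => hV x.1 x.2
  obtain ⟨t, ht, -⟩ := TopCat.Sheaf.existsUnique_gluing' ⟨F, hF⟩ (fun x : U => V x.1) U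
    (fun x => homOfLE (hV' x)) (fun x hxU => Opens.mem_iSup.2 ⟨⟨x, hxU⟩, hx x hxU⟩)
    (fun x => s x.1) (fun x y => section_eq_of_germ_eq hF fun z hz => by
      refine (F.germ_res_apply _ z hz _).trans (Eq.trans ?_ (F.germ_res_apply _ z hz _).symm)
      exact (hs x.1 x.2 z hz.1).trans (hs y.1 y.2 z hz.2).symm)
  refine ⟨t, fun x hxU => ?_⟩
  rw [← hs x hxU x (hx x hxU), ← ht ⟨x, hxU⟩]
  exact (F.germ_res_apply (homOfLE (hV' ⟨x, hxU⟩)) x (hx x hxU) t).symm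

variable {A : Type u} [Ring A]

/-- If `ρ : A → F(U)` followed by the germ at `x` extends to `A_𝐚`, then so does the restriction of
`ρ` to a neighbourhood of `x`. -/
theorem exists_chain_extension {U : Opens T} (ρ : A →+* F.obj (op U)) {x : T} (hx : x ∈ U) :
    ∀ {n : ℕ} (p : Chain A n), p.IsFraction → ∀ g : p.ring →+* F.stalk x,
      (∀ a, g (p.ofBase a) = (F.germ U x hx).hom (ρ a)) →
      ∃ (V : Opens T) (i : V ⟶ U) (k : p.ring →+* F.obj (op V)), x ∈ V ∧
        ∀ a, k (p.ofBase a) = (F.map i.op).hom (ρ a)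
  | 0, _, _, _, _ => ⟨U, 𝟙 U, ρ, hx, fun a => by rw [op_id, F.map_id]; rfl⟩
  | n + 1, p, ⟨hp, a, ha⟩, g, hg => by
    obtain ⟨V, i, k, hxV, hk⟩ := exists_chain_extension ρ hx p.init hp (g.comp p.ofInit) hg
    -- The two maps agree on `A`, hence everywhere; so the germ of `k a` is the image under `g` of
    -- an element inverted in `p.ring`.
    have e : (F.germ V x hxV).hom.comp k = g.comp p.ofInit := Chain.hom_ext fun b => by
      rw [RingHom.comp_apply, hk]
      exact (F.germ_res_apply i x hxV _).trans (hg b).symm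
    have hu : IsUnit ((F.germ V x hxV).hom (k a)) := by
      have := DFunLike.congr_fun e a
      rw [RingHom.comp_apply] at this
      rw [this]
      exact (Loc.isUnit_of p.last (ha ▸ Set.mem_singleton a)).map g
    obtain ⟨W, j, hxW, hW⟩ := exists_isUnit_res_of_isUnit_germ F hxV (k a) hu
    have hl : ∀ s ∈ p.last, IsUnit (((F.map j.op).hom.comp k) s) := fun s hs => by
      obtain rfl : s = a := by rwa [ha, Set.mem_singleton_iff] at hs
      exact hW
    refine ⟨W, j ≫ i, p.liftInit ((F.map j.op).hom.comp k) hl, hxW, fun b => ?_⟩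
    refine (p.liftInit_ofInit _ hl (p.init.ofBase b)).trans ?_
    rw [RingHom.comp_apply, hk, op_comp, F.map_comp]
    rfl

end Sheaf

/-! ### Stalks of the structure sheaf -/

section StructureSheaf

variable {A : Type u} [Ring A]

/-- Evaluation at `𝒮` of sections of the structure sheaf. -/
def evalAt (𝒮 : specTop A) (U : Opens (specTop A)) (h : 𝒮 ∈ U) :
    (structurePresheaf A).obj (op U) ⟶ RingCat.of (specLoc A 𝒮) :=
  RingCat.ofHom ((Pi.evalRingHom _ (⟨𝒮, h⟩ : U)).comp (sections A U).subtype)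

/-- The homomorphism from the stalk of the structure sheaf at `𝒮` to `A_𝒮`. -/
def stalkToLocalization (𝒮 : specTop A) :
    (structurePresheaf A).stalk 𝒮 ⟶ RingCat.of (specLoc A 𝒮) :=
  Limits.colimit.desc ((OpenNhds.inclusion 𝒮).op ⋙ structurePresheaf A)
    { pt := RingCat.of (specLoc A 𝒮)
      ι := { app := fun U => evalAt 𝒮 U.unop.1 U.unop.2 } }

theorem germ_stalkToLocalization (𝒮 : specTop A) (U : Opens (specTop A)) (h : 𝒮 ∈ U)
    (t : sections A U) :
    (stalkToLocalization 𝒮).hom (((structurePresheaf A).germ U 𝒮 h).hom t) = t.1 ⟨𝒮, h⟩ :=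
  DFunLike.congr_fun (congrArg RingCat.Hom.hom
    (Limits.colimit.ι_desc (F := (OpenNhds.inclusion 𝒮).op ⋙ structurePresheaf A)
    { pt := RingCat.of (specLoc A 𝒮)
      ι := { app := fun U => evalAt 𝒮 U.unop.1 U.unop.2 } } (op ⟨U, h⟩))) t

/-- The homomorphism from `A_𝐚` to sections of the structure sheaf over an open subset of
`D(𝐚)`. -/
def fractionToSections (a : Fraction A) (U : Opens (specTop A))
    (h : ∀ 𝒮 : U, a.Mem (point 𝒮.1)) : a.ring →+* sections A U where
  toFun b := ⟨fun 𝒮 => a.toLocalization (h 𝒮) b, fun x =>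
    ⟨U, x.2, 𝟙 _, a, b, fun 𝒮 => ⟨h 𝒮, rfl⟩⟩⟩
  map_one' := Subtype.ext (funext fun _ => map_one _)
  map_mul' _ _ := Subtype.ext (funext fun _ => map_mul _ _ _)
  map_zero' := Subtype.ext (funext fun _ => map_zero _)
  map_add' _ _ := Subtype.ext (funext fun _ => map_add _ _ _)

/-- The basic open set `D(𝐚)`. -/
def basicOpen (a : Fraction A) : Opens (specTop A) := ⟨a.basicSet, a.isOpen_basicSet⟩

/-- A section of the structure sheaf is locally given by elements of the rings `A_𝐚`. -/
theorem exists_fraction {U : Opens (specTop A)} (t : sections A U) {𝒮 : specTop A} (h : 𝒮 ∈ U) :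
    ∃ (V : Opens (specTop A)) (i : V ⟶ U) (_ : 𝒮 ∈ V) (a : Fraction A)
      (ha : ∀ 𝒯 : V, a.Mem (point 𝒯.1)) (b : a.ring),
      ((structurePresheaf A).map i.op).hom t = fractionToSections a V ha b := by
  obtain ⟨V, m, i, a, b, w⟩ := t.2 ⟨𝒮, h⟩
  exact ⟨V, i, m, a, fun 𝒯 => (w 𝒯).1, b, Subtype.ext (funext fun 𝒯 => (w 𝒯).2)⟩

/-- Near `𝒮` a germ is given by some `b ∈ A_𝐚`. If `b` is invertible in `A_𝒮`, it is already
invertible in `A_𝐜` for some `𝐜 ∈ 𝒮`, so the section is invertible on a neighbourhood inside `D(𝐜)`.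
-/
instance isLocalHom_stalkToLocalization (𝒮 : specTop A) :
    IsLocalHom (stalkToLocalization 𝒮).hom where
  map_nonunit y hy := by
    obtain ⟨U, hU, t, rfl⟩ := (structurePresheaf A).exists_germ_eq y
    obtain ⟨V, i, hV, a, ha, b, hb⟩ := exists_fraction t hU
    have hy' : IsUnit (a.toLocalization (ha ⟨𝒮, hV⟩) b) := by
      have h₁ := congrArg (fun s : sections A V => s.1 ⟨𝒮, hV⟩) hb
      have h₂ := germ_stalkToLocalization 𝒮 U hU t
      exact (congrArg IsUnit (h₂.trans h₁)).mp hy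
    obtain ⟨c, f, hf, hc, hfc⟩ := a.exists_isUnit_of_isUnit_toLocalization _ b hy'
    let W : Opens (specTop A) := V ⊓ basicOpen c
    have hW : 𝒮 ∈ W := ⟨hV, hc⟩
    let j : W ⟶ V := Opens.infLELeft _ _
    have e : ((structurePresheaf A).map (j ≫ i).op).hom t =
        fractionToSections c W (fun 𝒯 => 𝒯.2.2) (f b) := by
      rw [op_comp, (structurePresheaf A).map_comp]
      refine (congrArg ((structurePresheaf A).map j.op).hom hb).trans ?_
      exact Subtype.ext (funext fun 𝒯 =>
        (Fraction.toLocalization_comp (ha ⟨𝒯.1, 𝒯.2.1⟩) 𝒯.2.2 f hfc b).symm)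
    have hu : IsUnit (((structurePresheaf A).map (j ≫ i).op).hom t) :=
      (congrArg IsUnit e).mpr (hf.map _)
    have := hu.map ((structurePresheaf A).germ W 𝒮 hW).hom
    exact (congrArg IsUnit ((structurePresheaf A).germ_res_apply (j ≫ i) 𝒮 hW t)).mp this

/-- The homomorphism from `A` to the stalk of the structure sheaf at `𝒮`. -/
def toStalk (𝒮 : specTop A) : A →+* (structurePresheaf A).stalk 𝒮 :=
  ((structurePresheaf A).germ ⊤ 𝒮 trivial).hom.comp (toGlobalSections A).hom

theorem stalkToLocalization_comp_toStalk (𝒮 : specTop A) :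
    (stalkToLocalization 𝒮).hom.comp (toStalk 𝒮) = (point 𝒮).ofBase :=
  RingHom.ext fun a => germ_stalkToLocalization 𝒮 ⊤ trivial ((toGlobalSections A).hom a)

instance nontrivial_stalk (𝒮 : specTop A) : Nontrivial ((structurePresheaf A).stalk 𝒮) :=
  (stalkToLocalization 𝒮).hom.domain_nontrivial

theorem ofHom_toStalk (𝒮 : specTop A) : FullSpec.ofHom (toStalk 𝒮) = point 𝒮 := by
  refine (FullSpec.ofHom_comp (stalkToLocalization 𝒮).hom (toStalk 𝒮)).symm.trans ?_
  rw [stalkToLocalization_comp_toStalk]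
  exact (point 𝒮).ofHom_ofBase

end StructureSheaf

namespace FScheme

/-- The stalk is isomorphic to a stalk of some `𝒪_R`, which maps to a nonzero `R_𝒮`. Hence `A →
𝒪_{X,x}` defines a point of `F(A)`. -/
instance nontrivial_stalk (X : FScheme.{u}) (x : X.carrier) :
    Nontrivial (X.presheaf.stalk x) := by
  obtain ⟨U, hx, R, _, ⟨e⟩⟩ := X.locally_affine x
  let e' := (SheafedSpace.forgetToPresheafedSpace (C := RingCat.{u})).mapIso e
  let i := X.toPresheafedSpace.restrictStalkIso U.isOpenEmbedding ⟨x, hx⟩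
  let φ : (structurePresheaf R).stalk (e'.hom.base ⟨x, hx⟩) ≅ X.presheaf.stalk x :=
    PresheafedSpace.stalkMap.stalkIso e' ⟨x, hx⟩ ≪≫ i
  have := FSch.nontrivial_stalk (A := R) (e'.hom.base ⟨x, hx⟩)
  exact φ.inv.hom.domain_nontrivial

variable {X : FScheme.{u}} {A : Type u} [Ring A]

/-! ### The morphism determined by a homomorphism to global sections -/

section Construction

variable (ρ : A →+* X.globalSections)

/-- The composite of `ρ : A → Γ(X, 𝒪_X)` and the germ at `x`. -/
def germHom (x : X.carrier) : A →+* X.presheaf.stalk x :=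
  (X.presheaf.germ ⊤ x trivial).hom.comp ρ

/-- The point of `F(A)` determined by `ρ : A → Γ(X, 𝒪_X)` and a point of `X`. -/
def pointMap (x : X.carrier) : specTop A := FullSpec.ofHom (germHom ρ x)

/-- A fraction `𝐚` that belongs to the image of `x` acts on a neighbourhood of `x`. -/
theorem exists_fraction_extension (a : Fraction A) {x : X.carrier}
    (h : a.Mem (point (pointMap ρ x))) : ∃ (V : Opens X.carrier)
      (k : a.ring →+* X.presheaf.obj (op V)), x ∈ V ∧
        ∀ (y : X.carrier) (hy : y ∈ V) (b : A),
          (X.presheaf.germ V y hy).hom (k (a.chain.ofBase b)) = germHom ρ y b := by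
  obtain ⟨g, hg⟩ := (a.mem_ofHom_iff (germHom ρ x)).1 h
  obtain ⟨V, i, k, hx, hk⟩ := exists_chain_extension (F := X.presheaf) (U := ⊤) ρ trivial
    a.chain a.isFraction g hg
  refine ⟨V, k, hx, fun y hy b => ?_⟩
  refine (congrArg (X.presheaf.germ V y hy).hom (hk b)).trans ?_
  exact X.presheaf.germ_res_apply i y hy (ρ b)

/-- If `𝐚 ∈ f(x)`, the extension of `ρ` to `A_𝐚` over a neighbourhood of `x` has germs that witness
`𝐚 ∈ f(y)` for all `y` there. -/
theorem continuous_pointMap : Continuous (pointMap ρ) := by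
  refine continuous_generateFrom_iff.2 ?_
  rintro _ ⟨a, rfl⟩
  refine isOpen_iff_mem_nhds.2 fun x hx => ?_
  obtain ⟨V, k, hxV, hk⟩ := exists_fraction_extension ρ a hx
  refine Filter.mem_of_superset (V.isOpen.mem_nhds hxV) fun y hy => ?_
  exact (a.mem_ofHom_iff (germHom ρ y)).2
    ⟨(X.presheaf.germ V y hy).hom.comp k, fun b => hk y hy b⟩

/-- The continuous map `X → F(A)` determined by `ρ : A → Γ(X, 𝒪_X)`. -/
def baseMap : X.carrier ⟶ specTop A := TopCat.ofHom ⟨pointMap ρ, continuous_pointMap ρ⟩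

/-- The homomorphism `A_{f(x)} → 𝒪_{X,x}` induced by `ρ`, where `f` is the map determined by
`ρ`. -/
def locToStalk (x : X.carrier) : specLoc A (pointMap ρ x) →+* X.presheaf.stalk x :=
  FullSpec.toTarget (germHom ρ x)

instance isLocalHom_locToStalk (x : X.carrier) : IsLocalHom (locToStalk ρ x) :=
  FullSpec.isLocalHom_toTarget (germHom ρ x)

/-- Near `f(x)` the section `t` is given by `b ∈ A_𝐚`, and `A_𝐚` maps to sections of `𝒪_X` near `x`;
the image of `b` has the prescribed germs. -/
theorem exists_pullback_section (U : Opens (specTop A)) (t : sections A U) :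
    ∃ s : X.presheaf.obj (op ((Opens.map (baseMap ρ)).obj U)),
      ∀ (x : X.carrier) (hx : pointMap ρ x ∈ U),
        (X.presheaf.germ ((Opens.map (baseMap ρ)).obj U) x hx).hom s =
          locToStalk ρ x (t.1 ⟨pointMap ρ x, hx⟩) := by
  classical
  -- The value `0` off the preimage of `U` is a default that is never used.
  let σ : ∀ x : X.carrier, X.presheaf.stalk x := fun x =>
    if hx : pointMap ρ x ∈ U then locToStalk ρ x (t.1 ⟨pointMap ρ x, hx⟩) else 0
  obtain ⟨s, hs⟩ := exists_section_of_germs X.IsSheaf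
    (U := (Opens.map (baseMap ρ)).obj U) σ fun x hx => by
      obtain ⟨V, i, hxV, a, ha, b, hb⟩ := exists_fraction t hx
      obtain ⟨W, k, hxW, hk⟩ := exists_fraction_extension ρ a (ha ⟨pointMap ρ x, hxV⟩)
      let j : W ⊓ (Opens.map (baseMap ρ)).obj V ⟶ W := Opens.infLELeft _ _
      refine ⟨W ⊓ (Opens.map (baseMap ρ)).obj V, fun y hy => i.le hy.2,
        (X.presheaf.map j.op).hom (k b), ⟨hxW, hxV⟩, fun y hy => ?_⟩
      have hyU : pointMap ρ y ∈ U := i.le hy.2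
      have h₁ : t.1 ⟨pointMap ρ y, hyU⟩ = a.toLocalization (ha ⟨pointMap ρ y, hy.2⟩) b :=
        congrArg (fun s : sections A V => s.1 ⟨pointMap ρ y, hy.2⟩) hb
      refine (X.presheaf.germ_res_apply j y hy (k b)).trans ?_
      refine Eq.trans ?_ (dif_pos hyU).symm
      rw [h₁]
      exact (a.toTarget_toLocalization (germHom ρ y) (ha ⟨pointMap ρ y, hy.2⟩)
        ((X.presheaf.germ W y hy.1).hom.comp k) (fun c => hk y hy.1 c) b).symm
  exact ⟨s, fun x hx => (hs x hx).trans (dif_pos hx)⟩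

/-- The section of `𝒪_X` over `f⁻¹(U)` obtained from a section of `𝒪_A` over `U`, where `f` is
the map determined by `ρ`. -/
def pullbackSection (U : Opens (specTop A)) (t : sections A U) :
    X.presheaf.obj (op ((Opens.map (baseMap ρ)).obj U)) :=
  (exists_pullback_section ρ U t).choose

theorem germ_pullbackSection (U : Opens (specTop A)) (t : sections A U) (x : X.carrier)
    (hx : pointMap ρ x ∈ U) :
    (X.presheaf.germ ((Opens.map (baseMap ρ)).obj U) x hx).hom (pullbackSection ρ U t) =
      locToStalk ρ x (t.1 ⟨pointMap ρ x, hx⟩) :=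
  (exists_pullback_section ρ U t).choose_spec x hx

/-- The homomorphism of sheaves `𝒪_A → f_* 𝒪_X` determined by `ρ`. -/
def sheafMap : structurePresheaf A ⟶ (TopCat.Presheaf.pushforward _ (baseMap ρ)).obj X.presheaf where
  app U := RingCat.ofHom
    { toFun := pullbackSection ρ U.unop
      map_one' := section_eq_of_germ_eq X.IsSheaf fun x hx =>
        (germ_pullbackSection ρ _ _ x hx).trans ((map_one _).trans (map_one _).symm)
      map_mul' := fun s t => section_eq_of_germ_eq X.IsSheaf fun x hx => by
        rw [map_mul]
        refine (germ_pullbackSection ρ _ _ x hx).trans ((map_mul _ _ _).trans ?_)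
        exact congrArg₂ (· * ·) (germ_pullbackSection ρ _ s x hx).symm
          (germ_pullbackSection ρ _ t x hx).symm
      map_zero' := section_eq_of_germ_eq X.IsSheaf fun x hx =>
        (germ_pullbackSection ρ _ _ x hx).trans ((map_zero _).trans (map_zero _).symm)
      map_add' := fun s t => section_eq_of_germ_eq X.IsSheaf fun x hx => by
        rw [map_add]
        refine (germ_pullbackSection ρ _ _ x hx).trans ((map_add _ _ _).trans ?_)
        exact congrArg₂ (· + ·) (germ_pullbackSection ρ _ s x hx).symm
          (germ_pullbackSection ρ _ t x hx).symm }
  naturality U V i := by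
    refine RingCat.hom_ext (RingHom.ext fun t => ?_)
    refine section_eq_of_germ_eq X.IsSheaf fun x hx => ?_
    refine (germ_pullbackSection ρ V.unop _ x hx).trans ?_
    refine Eq.trans ?_ (X.presheaf.germ_res_apply ((Opens.map (baseMap ρ)).map i.unop) x hx
      (pullbackSection ρ U.unop t)).symm
    exact (germ_pullbackSection ρ U.unop t x (i.unop.le hx)).symm

/-- The morphism of ringed spaces `X → F(A)` determined by `ρ : A → Γ(X, 𝒪_X)`. -/
def toSpec : X.toPresheafedSpace.Hom (affine A).toPresheafedSpace := ⟨baseMap ρ, sheafMap ρ⟩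

/-- This factorization through `A_{f(x)}` exhibits the stalk map as a composite of two local
homomorphisms. -/
theorem stalkMap_toSpec (x : X.carrier) :
    ((toSpec ρ).stalkMap x).hom =
      (locToStalk ρ x).comp (stalkToLocalization (pointMap ρ x)).hom := by
  refine RingHom.ext fun y => ?_
  obtain ⟨U, hU, t, rfl⟩ := (structurePresheaf A).exists_germ_eq y
  refine (DFunLike.congr_fun (congrArg RingCat.Hom.hom
    (PresheafedSpace.stalkMap_germ (toSpec ρ) U x hU)) t).trans ?_
  refine (germ_pullbackSection ρ U t x hU).trans ?_
  exact congrArg (locToStalk ρ x) (germ_stalkToLocalization (pointMap ρ x) U hU t).symm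

/-- The morphism of F-schemes `X → F(A)` determined by `ρ : A → Γ(X, 𝒪_X)`. -/
def ofRingHom : X ⟶ affine A where
  toHom := toSpec ρ
  isLocal x := by
    have h₁ : IsLocalHom (locToStalk ρ x) := inferInstance
    have h₂ : IsLocalHom (stalkToLocalization (pointMap ρ x)).hom := inferInstance
    rw [stalkMap_toSpec]
    exact ⟨fun a h => h₂.map_nonunit a (h₁.map_nonunit _ h)⟩

theorem homToRingHom_ofRingHom : homToRingHom X A (ofRingHom ρ) = ρ :=
  RingHom.ext fun a => section_eq_of_germ_eq X.IsSheaf fun x _ =>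
    germ_pullbackSection ρ ⊤ ((toGlobalSections A).hom a) x trivial

end Construction

/-! ### A morphism is determined by its effect on `A` -/

section Uniqueness

/-- The underlying map of a morphism to `F(A)` is determined by the homomorphism on `A`. -/
theorem base_eq_pointMap (f : Hom X (affine A)) (x : X.carrier) :
    f.toHom.base x = pointMap (homToRingHom X A f) x := by
  have := f.isLocal x
  have e : (f.toHom.stalkMap x).hom.comp (toStalk (f.toHom.base x)) =
      germHom (homToRingHom X A f) x := RingHom.ext fun a =>
    DFunLike.congr_fun (congrArg RingCat.Hom.hom
      (PresheafedSpace.stalkMap_germ f.toHom ⊤ x trivial)) ((toGlobalSections A).hom a)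
  -- Locality of the stalk map enters here: the system of `A → 𝒪_{A,f(x)}` is unchanged by composing
  -- with it.
  refine (ofHom_toStalk (f.toHom.base x)).symm.trans ?_
  refine (FullSpec.ofHom_comp (f.toHom.stalkMap x).hom (toStalk (f.toHom.base x))).symm.trans ?_
  exact congrArg (fun φ => FullSpec.ofHom φ) e

/-- A homomorphism of sheaves from `𝒪_A` is determined by its effect on `A`. -/
theorem sheafHom_ext {b : X.carrier ⟶ specTop A}
    {c c' : structurePresheaf A ⟶ (TopCat.Presheaf.pushforward _ b).obj X.presheaf}
    (h : ∀ a : A, (c.app (op ⊤)).hom ((toGlobalSections A).hom a) =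
      (c'.app (op ⊤)).hom ((toGlobalSections A).hom a)) : c = c' := by
  refine NatTrans.ext (funext fun U => RingCat.hom_ext (RingHom.ext fun t => ?_))
  refine section_eq_of_germ_eq X.IsSheaf fun x hx => ?_
  obtain ⟨V, i, hV, a, ha, y, hy⟩ := exists_fraction (U := U.unop) t hx
  have nat : ∀ (d : structurePresheaf A ⟶ (TopCat.Presheaf.pushforward _ b).obj X.presheaf)
      {P Q : Opens (specTop A)} (j : P ⟶ Q) (s : sections A Q),
      (d.app (op P)).hom (((structurePresheaf A).map j.op).hom s) =
        (X.presheaf.map ((Opens.map b).map j).op).hom ((d.app (op Q)).hom s) := fun d P Q j s =>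
    DFunLike.congr_fun (congrArg RingCat.Hom.hom (d.naturality j.op)) s
  -- On `V` the section comes from `A_𝐚`, so the epimorphism `A → A_𝐚` reduces the comparison to
  -- elements of `A`.
  have e : (c.app (op V)).hom.comp (fractionToSections a V ha) =
      (c'.app (op V)).hom.comp (fractionToSections a V ha) := Chain.hom_ext fun z => by
    have hz : fractionToSections a V ha (a.chain.ofBase z) =
        ((structurePresheaf A).map (homOfLE (le_top : V ≤ ⊤)).op).hom
          ((toGlobalSections A).hom z) :=
      Subtype.ext (funext fun 𝒯 => a.toLocalization_ofBase (ha 𝒯) z)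
    refine (congrArg (c.app (op V)).hom hz).trans
      (Eq.trans ?_ (congrArg (c'.app (op V)).hom hz).symm)
    refine (nat c _ _).trans (Eq.trans ?_ (nat c' _ _).symm)
    exact congrArg _ (h z)
  have key : ∀ d : structurePresheaf A ⟶ (TopCat.Presheaf.pushforward _ b).obj X.presheaf,
      (X.presheaf.germ _ x hx).hom ((d.app U).hom t) =
        (X.presheaf.germ ((Opens.map b).obj V) x hV).hom
          ((d.app (op V)).hom (fractionToSections a V ha y)) := fun d => by
    refine Eq.trans ?_ (congrArg (fun s => (X.presheaf.germ ((Opens.map b).obj V) x hV).hom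
      ((d.app (op V)).hom s)) hy)
    refine Eq.trans ?_ (congrArg (X.presheaf.germ ((Opens.map b).obj V) x hV).hom
      (nat d i t)).symm
    exact (X.presheaf.germ_res_apply ((Opens.map b).map i) x hV _).symm
  refine (key c).trans (Eq.trans ?_ (key c').symm)
  exact congrArg _ (DFunLike.congr_fun e y)

theorem homToRingHom_injective : Function.Injective (homToRingHom X A) := by
  intro f g h
  have hb : f.toHom.base = g.toHom.base := by
    refine TopCat.ext fun x => ?_
    refine (base_eq_pointMap f x).trans (Eq.trans ?_ (base_eq_pointMap g x).symm)
    rw [h]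
  refine Hom.ext_toHom ?_
  obtain ⟨⟨b, c⟩, hf⟩ := f
  obtain ⟨⟨b', c'⟩, hg⟩ := g
  obtain rfl : b = b' := hb
  exact congrArg (PresheafedSpace.Hom.mk b) (sheafHom_ext fun a => DFunLike.congr_fun h a)

end Uniqueness

end FScheme

end

end FSch

theorem mainTheorem3 (X : FSch.FScheme.{u}) (A : Type u) [Ring A] :
    Function.Bijective (FSch.FScheme.homToRingHom X A) :=
  ⟨FSch.FScheme.homToRingHom_injective,
    fun ρ => ⟨FSch.FScheme.ofRingHom ρ, FSch.FScheme.homToRingHom_ofRingHom ρ⟩⟩
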